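/- Let $X$ be a real Banach space, let $A$ be the infinitesimal generator of a $C_0$-semigroup $S(t)$ on $X$, and let $B$ be a bounded linear operator on $X$. For $y\in X$ let $J(y)=\{\varphi\in X^*:\ \langle y,\varphi\rangle=\|y\|^2=\|\varphi\|^2\}$ be the duality map. Consider the bilinear system $$\text{(BLS)}\qquad \dot z(t)=Az(t)+u(t)Bz(t),\quad z(0)=z_0\in X .$$ Assume $(\mathcal A_2)$ the mapping $B_J:y\mapsto\langle By,J(y)\rangle$ is single-valued (i.e. $\langle By,\varphi\rangle$ does not depend on the choice of $\varphi\in J(y)$) and satisfies $|B_J(y)-B_J(z)|\le \mathcal K(\|y\|,\|z\|)\,\|y-z\|$ for all $y,z\in X$, where $\mathcal K:[0,\infty)^2\to[0,\infty)$ is increasing (if $0\le s_1\le r_1$ and $0\le s_2\le r_2$ then $\mathcal K(s_1,s_2)\le\mathcal K(r_1,r_2)$), $s\mapsto\mathcal K(s,s)$ is continuous, and $\mathcal K(s,s)\le Cs$ for all $s\ge0$ and some $C>0$; and assume that $S(t)$ is a semigroup of isometries: $\|S(t)y\|=\|y\|$ for all $t\ge0$, $y\in X$. **Theorem.** Suppose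 that for some $\lambda>0$ the feedback control $$u(t)=-\lambda\,\frac{\langle Bz(t),J(z(t))\rangle}{\|z(t)\|^2}\ \text{ if } z(t)\neq0,\qquad u(t)=0\ \text{ if } z(t)=0,$$ uniformly exponentially stabilizes (BLS), i.e. there are constants $M,\sigma>0$ such that for every $z_0\in X$ the closed-loop system has a unique mild solution $z$ on $[0,\infty)$ (a continuous function satisfying $z(t)=S(t)z_0+\int_0^t u(s)S(t-s)Bz(s)\,ds$ for all $t\ge 0$), and this solution satisfies $\|z(t)\|\le Me^{-\sigma t}\|z_0\|$ for all $t\ge0$. Then the observation estimate holds: $(\mathcal A_3)$ there exist $T,\delta>0$ such that $$\int_0^T|\langle BS(t)y,J(S(t)y)\rangle|\,dt\ \ge\ \delta\,\|S(T)y\|^2\qquad\forall y\in X .$$ -/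

import Mathlib

open Set Filter Topology MeasureTheory
open scoped NNReal

namespace BilinearStab

noncomputable section

variable {X : Type*} [NormedAddCommGroup X] [NormedSpace ℝ X]

/-- `S` (used for times `t ≥ 0` only) is a strongly continuous semigroup of bounded linear
operators on `X`. -/
structure IsC0Semigroup (S : ℝ → X →L[ℝ] X) : Prop where
  zero : S 0 = ContinuousLinearMap.id ℝ X
  add : ∀ s t : ℝ, 0 ≤ s → 0 ≤ t → S (s + t) = (S s).comp (S t)
  tendsto_zero : ∀ x : X, Tendsto (fun t : ℝ => S t x) (𝓝[>] 0) (𝓝 x)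

/-- The (unbounded) operator `A` is the infinitesimal generator of `S`: its domain is the set of
all `x` for which `(S h x - x) / h` converges as `h → 0+`, and `A x` is the limit. -/
def IsGenerator (A : X →ₗ.[ℝ] X) (S : ℝ → X →L[ℝ] X) : Prop :=
  ∀ x y : X, (x, y) ∈ A.graph ↔
    Tendsto (fun h : ℝ => h⁻¹ • (S h x - x)) (𝓝[>] 0) (𝓝 y)

/-- `S` is a semigroup of isometries. -/
def IsIsometric (S : ℝ → X →L[ℝ] X) : Prop :=
  ∀ t : ℝ, 0 ≤ t → ∀ y : X, ‖S t y‖ = ‖y‖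

/-- The (multi-valued) duality map `J : X → 2^{X*}`. -/
def dualityMap (y : X) : Set (StrongDual ℝ X) :=
  {φ | φ y = ‖y‖ ^ 2 ∧ ‖φ‖ ^ 2 = ‖y‖ ^ 2}

theorem dualityMap_nonempty (y : X) : (dualityMap y).Nonempty := by
  by_cases hy : y = 0
  · exact ⟨0, by simp [dualityMap, hy]⟩
  · obtain ⟨g, hg1, hg2⟩ := exists_dual_vector ℝ y (norm_ne_zero_iff.mpr hy)
    refine ⟨‖y‖ • g, ?_, ?_⟩
    · simp only [RCLike.ofReal_real_eq_id, id] at hg2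
      simp [hg2, sq]
    · simp [norm_smul, hg1]

/-- The multi-valued map `y ↦ ⟨B y, J(y)⟩ = {⟨B y, φ⟩ : φ ∈ J(y)}` is single-valued. -/
def BJSingleValued (B : X →L[ℝ] X) : Prop :=
  ∀ y : X, ∀ φ ∈ dualityMap y, ∀ ψ ∈ dualityMap y, φ (B y) = ψ (B y)

/-- `B_J(y) = ⟨B y, J(y)⟩`: the value `⟨B y, φ⟩` for some `φ ∈ J(y)`. It is independent of the
choice of `φ` when `B_J` is single-valued, see `BJ_eq`. -/
def BJ (B : X →L[ℝ] X) (y : X) : ℝ :=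
  (dualityMap_nonempty y).some (B y)

theorem BJ_eq {B : X →L[ℝ] X} (hB : BJSingleValued B) {y : X} {φ : StrongDual ℝ X}
    (hφ : φ ∈ dualityMap y) : BJ B y = φ (B y) :=
  hB y _ (dualityMap_nonempty y).some_mem _ hφ

/-- Assumption (A2): `B_J` is single-valued, with
`|B_J(y) - B_J(z)| ≤ K(‖y‖, ‖z‖) ‖y - z‖`, where `K : [0,∞)² → [0,∞)` is increasing,
`s ↦ K(s, s)` is continuous and `K(s, s) ≤ C s` for some `C > 0`. -/
def AssumptionA2 (B : X →L[ℝ] X) : Prop :=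
  BJSingleValued B ∧
  ∃ K : ℝ≥0 → ℝ≥0 → ℝ≥0,
    (∀ y z : X, |BJ B y - BJ B z| ≤ K ‖y‖₊ ‖z‖₊ * ‖y - z‖) ∧
    (∀ s₁ r₁ s₂ r₂ : ℝ≥0, s₁ ≤ r₁ → s₂ ≤ r₂ → K s₁ s₂ ≤ K r₁ r₂) ∧
    Continuous (fun s : ℝ≥0 => K s s) ∧
    ∃ C : ℝ≥0, 0 < C ∧ ∀ s : ℝ≥0, K s s ≤ C * s

/-- Assumption (A3), the observation estimate. -/
def AssumptionA3 (S : ℝ → X →L[ℝ] X) (B : X →L[ℝ] X) : Prop :=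
  ∃ T δ : ℝ, 0 < T ∧ 0 < δ ∧
    ∀ y : X, δ * ‖S T y‖ ^ 2 ≤ ∫ t in (0 : ℝ)..T, |BJ B (S t y)|

/-- `z` is a (global) mild solution on `[0,∞)` of `z' = A z + u(t) B z`, `z(0) = z₀`, where `S` is
the semigroup generated by `A`: it is continuous and satisfies the variation of constants formula.
-/
def IsMildSolution (S : ℝ → X →L[ℝ] X) (B : X →L[ℝ] X) (u : ℝ → ℝ) (z₀ : X) (z : ℝ → X) : Prop :=
  ContinuousOn z (Ici 0) ∧
  ∀ t : ℝ, 0 ≤ t →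
    IntervalIntegrable (fun s : ℝ => u s • S (t - s) (B (z s))) volume 0 t ∧
    z t = S t z₀ + ∫ s in (0 : ℝ)..t, u s • S (t - s) (B (z s))

open Classical in
/-- The normalized feedback law with gain `lam`. -/
def feedback (B : X →L[ℝ] X) (lam : ℝ) (y : X) : ℝ :=
  if y = 0 then 0 else -lam * (BJ B y / ‖y‖ ^ 2)

/-- `z` is a mild solution of the bilinear system closed with the normalized feedback. -/
def IsClosedLoopSolution (S : ℝ → X →L[ℝ] X) (B : X →L[ℝ] X) (lam : ℝ) (z₀ : X) (z : ℝ → X) :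
    Prop :=
  IsMildSolution S B (fun t => feedback B lam (z t)) z₀ z

/-- The normalized feedback with gain `lam` uniformly exponentially stabilizes the system: there
are `M, σ > 0` such that for each initial state the closed-loop system has a unique mild solution
(on `[0,∞)`), and it satisfies `‖z(t)‖ ≤ M e^{-σ t} ‖z₀‖`. -/
def UniformlyExpStabilizes (S : ℝ → X →L[ℝ] X) (B : X →L[ℝ] X) (lam : ℝ) : Prop :=
  ∃ M σ : ℝ, 0 < M ∧ 0 < σ ∧ ∀ z₀ : X, ∃ z : ℝ → X,
    IsClosedLoopSolution S B lam z₀ z ∧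
    (∀ w : ℝ → X, IsClosedLoopSolution S B lam z₀ w → EqOn w z (Ici 0)) ∧
    ∀ t : ℝ, 0 ≤ t → ‖z t‖ ≤ M * Real.exp (-σ * t) * ‖z₀‖

end

end BilinearStab

namespace BilinearStab

/-! Exponential decay gives a time `T`, the same for all `y`, by which the closed-loop solution `z`
from `y` has lost half its norm, whereas the free orbit `S t y` keeps norm `‖y‖`. So the two
separate by at least `‖y‖ / 2`, and only the control term can cause this. While `‖z‖` exceeds `‖y‖ /
2`, that term is at most a multiple of `|BJ B z| / ‖y‖`. The Lipschitz bound replaces `z` by the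
free orbit at a cost proportional to `‖y‖` times their distance. The powers of `‖y‖` cancel in the
Grönwall rate, so `‖y‖ ^ 2` is bounded by a uniform constant times the observation integral. -/

/-- Grönwall's inequality in integral form. -/
theorem le_mul_exp_of_le_add_mul_integral {D : ℝ → ℝ} {a c τ : ℝ} (hτ : 0 ≤ τ)
    (hD : ContinuousOn D (Icc 0 τ)) (hD0 : ∀ t, 0 ≤ D t) (ha : 0 ≤ a) (hc : 0 ≤ c)
    (h : ∀ t ∈ Icc 0 τ, D t ≤ a + c * ∫ s in (0 : ℝ)..t, D s) :
    D τ ≤ a * Real.exp (c * τ) := by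
  -- Extending `D` continuously to the line makes its primitive differentiable everywhere, endpoints
  -- included.
  set E : ℝ → ℝ := IccExtend hτ ((Icc 0 τ).domRestrict D) with hE
  have hEc : Continuous E := (continuousOn_iff_continuous_domRestrict.1 hD).Icc_extend'
  have hED : ∀ t ∈ Icc 0 τ, E t = D t := fun t ht => by
    rw [hE, IccExtend_of_mem hτ _ ht]; rfl
  have hint : ∀ t ∈ Icc 0 τ, ∫ s in (0 : ℝ)..t, D s = ∫ s in (0 : ℝ)..t, E s := by
    intro t ht
    refine intervalIntegral.integral_congr fun s hs => ?_
    rw [uIcc_of_le ht.1] at hs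
    exact (hED s ⟨hs.1, hs.2.trans ht.2⟩).symm
  set F : ℝ → ℝ := fun t => a + c * ∫ s in (0 : ℝ)..t, E s with hF
  have hder : ∀ t, HasDerivAt F (c * E t) t := fun t =>
    ((intervalIntegral.integral_hasDerivAt_right (hEc.intervalIntegrable _ _)
      (hEc.stronglyMeasurableAtFilter _ _) hEc.continuousAt).const_mul c).const_add a
  have hDF : ∀ t ∈ Icc 0 τ, D t ≤ F t := fun t ht => by
    rw [hF]; simpa only [hint t ht] using h t ht
  have hgr := norm_le_gronwallBound_of_norm_deriv_right_le (f := F) (f' := fun t => c * E t)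
    (δ := a) (K := c) (ε := 0) (a := 0) (b := τ)
    (fun t _ => (hder t).continuousAt.continuousWithinAt)
    (fun t _ => (hder t).hasDerivWithinAt) (by simp [hF, abs_of_nonneg ha])
    (fun t ht => by
      have ht' : t ∈ Icc 0 τ := ⟨ht.1, ht.2.le⟩
      rw [hED t ht', norm_mul, Real.norm_of_nonneg hc, Real.norm_of_nonneg (hD0 t), add_zero]
      exact mul_le_mul_of_nonneg_left ((hDF t ht').trans (Real.le_norm_self _)) hc)
    τ ⟨hτ, le_rfl⟩
  rw [gronwallBound_ε0, sub_zero] at hgr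
  exact (hDF τ ⟨hτ, le_rfl⟩).trans ((Real.le_norm_self _).trans hgr)

variable {X : Type*} [NormedAddCommGroup X] [NormedSpace ℝ X]

/-- The orbits of an isometric `C₀`-semigroup are continuous on `[0, ∞)`. -/
theorem IsC0Semigroup.continuousOn_orbit {S : ℝ → X →L[ℝ] X} (hS : IsC0Semigroup S)
    (hiso : IsIsometric S) (y : X) : ContinuousOn (fun t => S t y) (Ici 0) := by
  have hdist : ∀ s t : ℝ, 0 ≤ s → s ≤ t → ‖S t y - S s y‖ = ‖S (t - s) y - y‖ := by
    intro s t hs hst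
    have : S t y = S s (S (t - s) y) := by
      rw [← ContinuousLinearMap.comp_apply, ← hS.add s (t - s) hs (sub_nonneg.2 hst),
        add_sub_cancel]
    rw [this, ← map_sub, hiso s hs]
  -- Isometry shifts every increment to time `0`, so right continuity there yields continuity from
  -- both sides.
  have hdist' : ∀ s t : ℝ, 0 ≤ s → 0 ≤ t → dist (S t y) (S s y) = ‖S |t - s| y - y‖ := by
    intro s t hs ht
    rw [dist_eq_norm]
    rcases le_total s t with h | h
    · rw [hdist s t hs h, abs_of_nonneg (sub_nonneg.2 h)]
    · rw [norm_sub_rev, hdist t s ht h, abs_sub_comm, abs_of_nonneg (sub_nonneg.2 h)]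
  have hlim : Tendsto (fun h : ℝ => ‖S h y - y‖) (𝓝[≥] 0) (𝓝 0) := by
    rw [← Ioi_insert, nhdsWithin_insert, tendsto_sup]
    constructor
    · rw [tendsto_pure_left]
      intro s hs
      simpa [hS.zero] using mem_of_mem_nhds hs
    · simpa using ((hS.tendsto_zero y).sub_const y).norm
  intro s hs
  rw [ContinuousWithinAt, tendsto_iff_dist_tendsto_zero]
  have habs : Tendsto (fun t : ℝ => |t - s|) (𝓝[Ici 0] s) (𝓝[≥] 0) := by
    refine tendsto_nhdsWithin_iff.2 ⟨?_, Eventually.of_forall fun t => mem_Ici.2 (abs_nonneg _)⟩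
    have : Continuous fun t : ℝ => |t - s| := by fun_prop
    simpa using (this.tendsto s).mono_left nhdsWithin_le_nhds
  refine (hlim.comp habs).congr' ?_
  filter_upwards [self_mem_nhdsWithin] with t ht
  exact (hdist' s t hs ht).symm

/-- Under (A2), `B_J` is Lipschitz on every ball, with constant proportional to the radius. -/
theorem AssumptionA2.exists_abs_sub_le {B : X →L[ℝ] X} (hB : AssumptionA2 B) :
    ∃ C : ℝ, 0 < C ∧ ∀ (r : ℝ) (y z : X), ‖y‖ ≤ r → ‖z‖ ≤ r →
      |BJ B y - BJ B z| ≤ C * r * ‖y - z‖ := by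
  obtain ⟨-, K, hK, hmono, -, C, hC, hKC⟩ := hB
  refine ⟨C, hC, fun r y z hy hz => (hK y z).trans ?_⟩
  lift r to ℝ≥0 using (norm_nonneg y).trans hy
  gcongr
  exact_mod_cast (hmono _ _ _ _ hy hz).trans (hKC r)

theorem AssumptionA2.continuous_BJ {B : X →L[ℝ] X} (hB : AssumptionA2 B) :
    Continuous (BJ B) := by
  obtain ⟨C, -, hC⟩ := hB.exists_abs_sub_le
  rw [continuous_iff_continuousAt]
  intro y
  rw [ContinuousAt, tendsto_iff_dist_tendsto_zero]
  have hlim : Tendsto (fun z : X => C * (‖y‖ + 1) * ‖z - y‖) (𝓝 y) (𝓝 0) := by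
    have : Continuous fun z : X => C * (‖y‖ + 1) * ‖z - y‖ := by fun_prop
    simpa using this.tendsto y
  refine squeeze_zero' (Eventually.of_forall fun _ => dist_nonneg) ?_ hlim
  have hball : ∀ᶠ z in 𝓝 y, ‖z‖ < ‖y‖ + 1 :=
    continuous_norm.continuousAt.eventually_lt_const (lt_add_one _)
  filter_upwards [hball] with z hz
  exact hC _ z y hz.le (by linarith)

/-- A continuous real function descending from above `m` to at most `m` has a first time at which
it is at most `m`. -/
theorem exists_first_le {f : ℝ → ℝ} {T m : ℝ} (hT : 0 ≤ T) (hf : ContinuousOn f (Icc 0 T))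
    (hfT : f T ≤ m) : ∃ τ ∈ Icc 0 T, f τ ≤ m ∧ ∀ t, 0 ≤ t → t < τ → m < f t := by
  have hcpt : IsCompact (Icc 0 T ∩ f ⁻¹' Iic m) :=
    isCompact_Icc.of_isClosed_subset (hf.preimage_isClosed_of_isClosed isClosed_Icc isClosed_Iic)
      inter_subset_left
  obtain ⟨τ, ⟨hτ, hτm⟩, hleast⟩ := hcpt.exists_isLeast ⟨T, ⟨hT, le_rfl⟩, hfT⟩
  refine ⟨τ, hτ, hτm, fun t ht0 ht => ?_⟩
  by_contra! hle
  exact absurd (hleast ⟨⟨ht0, ht.le.trans hτ.2⟩, hle⟩) (not_le.2 ht)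

/-- As long as `‖z‖` stays above `m > 0`, the control term is bounded by a multiple of `|B_J|`. -/
theorem norm_feedback_smul_le {S : ℝ → X →L[ℝ] X} (hiso : IsIsometric S) (B : X →L[ℝ] X)
    {lam m r : ℝ} (hlam : 0 < lam) (hm : 0 < m) {z : X} (hz : m ≤ ‖z‖) (hr : 0 ≤ r) :
    ‖feedback B lam z • S r (B z)‖ ≤ lam * ‖B‖ / m * |BJ B z| := by
  have hz0 : 0 < ‖z‖ := hm.trans_le hz
  rw [norm_smul, hiso r hr, feedback, if_neg (norm_pos_iff.1 hz0), Real.norm_eq_abs, abs_mul,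
    abs_neg, abs_of_pos hlam, abs_div, abs_of_pos (pow_pos hz0 2)]
  calc lam * (|BJ B z| / ‖z‖ ^ 2) * ‖B z‖
      ≤ lam * (|BJ B z| / ‖z‖ ^ 2) * (‖B‖ * ‖z‖) := by gcongr; exact B.le_opNorm z
    _ = lam * ‖B‖ / ‖z‖ * |BJ B z| := by field_simp
    _ ≤ lam * ‖B‖ / m * |BJ B z| := by gcongr

/-- A closed-loop solution that stays bounded by `M ‖y‖` and has dropped to `‖y‖ / 2` by time `T`
forces a lower bound on the observation of the free orbit. -/
theorem sq_norm_le_integral_of_closedLoop {S : ℝ → X →L[ℝ] X} {B : X →L[ℝ] X}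
    (hS : IsC0Semigroup S) (hiso : IsIsometric S) (hBc : Continuous (BJ B)) {lam M C T : ℝ}
    (hlam : 0 < lam) (hM : 1 ≤ M) (hC : 0 < C) (hT : 0 ≤ T)
    (hlip : ∀ (r : ℝ) (y z : X), ‖y‖ ≤ r → ‖z‖ ≤ r → |BJ B y - BJ B z| ≤ C * r * ‖y - z‖)
    {y : X} (hy : y ≠ 0) {z : ℝ → X} (hz : IsClosedLoopSolution S B lam y z)
    (hbd : ∀ t, 0 ≤ t → ‖z t‖ ≤ M * ‖y‖) (hzT : ‖z T‖ ≤ ‖y‖ / 2) :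
    ‖y‖ ^ 2 ≤ 4 * lam * ‖B‖ * Real.exp (2 * lam * ‖B‖ * C * M * T) *
      ∫ t in (0 : ℝ)..T, |BJ B (S t y)| := by
  have hy0 : 0 < ‖y‖ := norm_pos_iff.2 hy
  obtain ⟨hzc, hzeq⟩ := hz
  have hSc := hS.continuousOn_orbit hiso y
  -- Stopping at the first halving time keeps the denominator in the feedback away from zero.
  obtain ⟨τ, hτ, hτle, hτlt⟩ := exists_first_le hT
    (hzc.mono Icc_subset_Ici_self).norm hzT
  set k : ℝ := lam * ‖B‖ / (‖y‖ / 2) with hk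
  have hk0 : 0 ≤ k := by positivity
  set D : ℝ → ℝ := fun t => ‖z t - S t y‖ with hDdef
  have hDc : ContinuousOn D (Ici 0) := (hzc.sub hSc).norm
  have hOc : ContinuousOn (fun t => |BJ B (S t y)|) (Ici 0) :=
    (hBc.comp_continuousOn hSc).abs
  have hDi : ∀ t, 0 ≤ t → IntervalIntegrable D volume 0 t := fun t ht =>
    (hDc.mono Icc_subset_Ici_self).intervalIntegrable_of_Icc ht
  have hOi : ∀ t, 0 ≤ t → IntervalIntegrable (fun t => |BJ B (S t y)|) volume 0 t := fun t ht =>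
    (hOc.mono Icc_subset_Ici_self).intervalIntegrable_of_Icc ht
  set I : ℝ := ∫ t in (0 : ℝ)..T, |BJ B (S t y)| with hI
  have hI0 : 0 ≤ I := intervalIntegral.integral_nonneg hT fun _ _ => abs_nonneg _
  have hBJ : ∀ s, 0 ≤ s → |BJ B (z s)| ≤ |BJ B (S s y)| + C * (M * ‖y‖) * D s := by
    intro s hs
    have h1 := hlip (M * ‖y‖) (z s) (S s y) (hbd s hs)
      (by rw [hiso s hs]; exact le_mul_of_one_le_left hy0.le hM)
    have h2 := abs_sub_abs_le_abs_sub (BJ B (z s)) (BJ B (S s y))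
    linarith
  have hDle : ∀ t ∈ Icc 0 τ, D t ≤ k * I + k * (C * (M * ‖y‖)) * ∫ s in (0 : ℝ)..t, D s := by
    intro t ht
    have hgi : IntervalIntegrable (fun s => k * (|BJ B (S s y)| + C * (M * ‖y‖) * D s))
        volume 0 t := ((hOi t ht.1).add ((hDi t ht.1).const_mul _)).const_mul _
    have hae : ∀ᵐ s : ℝ, s ∈ Ioc 0 t →
        ‖feedback B lam (z s) • S (t - s) (B (z s))‖ ≤
          k * (|BJ B (S s y)| + C * (M * ‖y‖) * D s) := by
      -- The lower bound on `‖z s‖` is known only before `τ`; the endpoint is a null set.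
      filter_upwards [Measure.ae_ne volume τ] with s hsτ hs
      have hlt : s < τ := lt_of_le_of_ne (hs.2.trans ht.2) hsτ
      refine (norm_feedback_smul_le hiso B hlam (half_pos hy0) (hτlt s hs.1.le hlt).le
        (sub_nonneg.2 hs.2)).trans ?_
      exact mul_le_mul_of_nonneg_left (hBJ s hs.1.le) hk0
    have hOle : ∫ s in (0 : ℝ)..t, |BJ B (S s y)| ≤ I :=
      intervalIntegral.integral_mono_interval le_rfl ht.1 (ht.2.trans hτ.2)
        (Eventually.of_forall fun _ => abs_nonneg _) (hOi T hT)
    calc D t = ‖∫ s in (0 : ℝ)..t, feedback B lam (z s) • S (t - s) (B (z s))‖ := by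
          rw [hDdef]; simp only; rw [(hzeq t ht.1).2, add_sub_cancel_left]
      _ ≤ ∫ s in (0 : ℝ)..t, k * (|BJ B (S s y)| + C * (M * ‖y‖) * D s) :=
          intervalIntegral.norm_integral_le_of_norm_le ht.1 hae hgi
      _ = k * (∫ s in (0 : ℝ)..t, |BJ B (S s y)|) +
            k * (C * (M * ‖y‖)) * ∫ s in (0 : ℝ)..t, D s := by
          rw [intervalIntegral.integral_const_mul,
            intervalIntegral.integral_add (hOi t ht.1) ((hDi t ht.1).const_mul _),
            intervalIntegral.integral_const_mul]
          ring
      _ ≤ _ := by gcongr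
  have hgr := le_mul_exp_of_le_add_mul_integral hτ.1 (hDc.mono Icc_subset_Ici_self)
    (fun t => norm_nonneg _) (mul_nonneg hk0 hI0) (by positivity) hDle
  have hDτ : ‖y‖ / 2 ≤ D τ := by
    have h1 : ‖S τ y‖ - ‖z τ‖ ≤ D τ := by
      rw [hDdef]; simp only; rw [norm_sub_rev]; exact norm_sub_norm_le _ _
    rw [hiso τ hτ.1] at h1
    linarith
  have hexp : k * (C * (M * ‖y‖)) * τ ≤ 2 * lam * ‖B‖ * C * M * T := by
    have : k * (C * (M * ‖y‖)) = 2 * lam * ‖B‖ * C * M := by rw [hk]; field_simp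
    rw [this]
    exact mul_le_mul_of_nonneg_left hτ.2 (by positivity)
  have hfin : ‖y‖ / 2 ≤ k * I * Real.exp (2 * lam * ‖B‖ * C * M * T) :=
    hDτ.trans (hgr.trans (mul_le_mul_of_nonneg_left (Real.exp_le_exp.2 hexp)
      (mul_nonneg hk0 hI0)))
  calc ‖y‖ ^ 2 = 2 * ‖y‖ * (‖y‖ / 2) := by ring
    _ ≤ 2 * ‖y‖ * (k * I * Real.exp (2 * lam * ‖B‖ * C * M * T)) := by gcongr
    _ = _ := by rw [hk]; field_simp; ring

end BilinearStab

theorem mainTheorem3 {X : Type*} [NormedAddCommGroup X] [NormedSpace ℝ X] [CompleteSpace X]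
    (A : X →ₗ.[ℝ] X) (S : ℝ → X →L[ℝ] X) (B : X →L[ℝ] X)
    (hS : BilinearStab.IsC0Semigroup S)
    (hA : BilinearStab.IsGenerator A S)
    (hA2 : BilinearStab.AssumptionA2 B)
    (hiso : BilinearStab.IsIsometric S)
    (hstab : ∃ lam : ℝ, 0 < lam ∧ BilinearStab.UniformlyExpStabilizes S B lam) :
    BilinearStab.AssumptionA3 S B := by
  obtain ⟨lam, hlam, M, σ, hM, hσ, hsol⟩ := hstab
  obtain ⟨C, hC, hlip⟩ := hA2.exists_abs_sub_le
  -- With `σ * T = 2 * M`, the bound `exp (2 * M) ≥ 2 * M + 1` gives decay by a factor of two.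
  set T : ℝ := 2 * M / σ with hTdef
  have hT : 0 < T := by positivity
  have hdecay : M * Real.exp (-σ * T) ≤ 1 / 2 := by
    have h1 : -σ * T = -(2 * M) := by rw [hTdef]; field_simp
    rw [h1, Real.exp_neg, ← div_eq_mul_inv, div_le_iff₀ (Real.exp_pos _)]
    linarith [Real.add_one_le_exp (2 * M)]
  -- `max M 1` makes one ball contain both `z` and the free orbit.
  set Q : ℝ := 4 * lam * ‖B‖ * Real.exp (2 * lam * ‖B‖ * C * max M 1 * T) with hQ
  have hQ0 : 0 ≤ Q := by positivity
  -- `Q` vanishes if `B = 0`, hence `Q + 1`.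
  refine ⟨T, 1 / (Q + 1), hT, by positivity, fun y => ?_⟩
  have hI0 : 0 ≤ ∫ t in (0 : ℝ)..T, |BilinearStab.BJ B (S t y)| :=
    intervalIntegral.integral_nonneg hT.le fun _ _ => abs_nonneg _
  rw [hiso T hT.le]
  by_cases hy : y = 0
  · simpa [hy] using hI0
  obtain ⟨z, hz, -, hzle⟩ := hsol y
  have hmain := BilinearStab.sq_norm_le_integral_of_closedLoop hS hiso hA2.continuous_BJ hlam
    (le_max_right M 1) hC hT.le hlip hy hz
    (fun t ht => (hzle t ht).trans <| by
      gcongr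
      calc M * Real.exp (-σ * t) ≤ M * 1 := by
            gcongr
            exact Real.exp_le_one_iff.2 (by nlinarith)
        _ ≤ max M 1 := by rw [mul_one]; exact le_max_left _ _)
    ((hzle T hT.le).trans <| by
      have := mul_le_mul_of_nonneg_right hdecay (norm_nonneg y)
      linarith)
  rw [one_div_mul_eq_div, div_le_iff₀ (by positivity)]
  linarith
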